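/- All groups are abelian, written additively. Let $\mathsf{HA}$ be the category of Hausdorff topological abelian groups and continuous homomorphisms. A subset $\Sigma$ of such a group $X$ is \emph{precompact} if for every open neighbourhood $U$ of $0$ there are finitely many $x_1,\dots,x_n\in X$ with $\Sigma\subseteq\bigcup_i (x_i+U)$. Let $\mathsf{LPA}\subset\mathsf{HA}$ be the full subcategory of \emph{locally precompact} groups ($0$ has a precompact neighbourhood), and $\mathsf{PGA}\subset\mathsf{LPA}$ the full subcategory of those locally precompact groups which are moreover \emph{precompactly generated} ($0$ has a precompact neighbourhood which generates the group as an abstract group). A sequence $X'\xrightarrow{i}X\xrightarrow{j}X''$ in $\mathsf{LPA}$ is \emph{exact} if it is a short exact sequence of the underlying abelian groups, $i$ is a closed map and $j$ is an open map. In a category with zero morphisms, kernels and cokernels, a morphism $f\colon A\to B$ is \emph{admissible} if the canonical morphism $\operatorname{coker}(\ker f\to A)\to\ker(B\to\operatorname{coker} f)$ is an isomorphism. An additive category is \emph{quasi-abelian} if all kernels and cokernels exist, pushouts of admissible monics along arbitrary morphisms exist and are admissible monics, and pullbacks of admissible epics along arbitrary morphisms exist and are admissible epics. Then: (1) If $X\in\mathsf{LPA}$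 and $A\subseteq X$ is a closed subgroup, then $A$ (with the subspace topology) and $X/A$ (with the quotient topology) lie in $\mathsf{LPA}$. (2) If $X\in\mathsf{PGA}$ and $A\subseteq X$ is a closed subgroup, then $A$ and $X/A$ lie in $\mathsf{PGA}$. (3) $\mathsf{PGA}$ is extension-closed in $\mathsf{LPA}$: if $X'\to X\to X''$ is an exact sequence in $\mathsf{LPA}$ with $X',X''\in\mathsf{PGA}$, then $X\in\mathsf{PGA}$. (4) Let $\mathsf{C}\in\{\mathsf{LPA},\mathsf{PGA}\}$ and let $f\colon X\to Y$ be a morphism in $\mathsf{C}$. (a) The group $\ker f=\{x\in X\mid f(x)=0\}$ with the subspace topology lies in $\mathsf{C}$, and with its inclusion into $X$ it is a kernel of $f$ both in $\mathsf{C}$ and in $\mathsf{HA}$; the inclusion is injective and closed. (b) The group $\operatorname{coker} f=Y/\overline{f(X)}$ with the quotient topology lies in $\mathsf{C}$, and with the projection from $Y$ it is a cokernel of $f$ both in $\mathsf{C}$ and in $\mathsf{HA}$; the projection is surjective and open. (c) $f$ is a monomorphism in $\mathsf{C}$ if and only if it is injective, if and only if $\ker f$ is zero. The closure $\overline{f(X)}$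 with the subspace topology lies in $\mathsf{C}$ and its inclusion into $Y$ is a kernel in $\mathsf{C}$ of $Y\to\operatorname{coker} f$. (d) $f$ is an epimorphism in $\mathsf{C}$ if and only if $f(X)$ is dense in $Y$, if and only if $\operatorname{coker} f$ is zero. The quotient $X/\ker f$ lies in $\mathsf{C}$ and the projection $X\to X/\ker f$ is a cokernel in $\mathsf{C}$ of $\ker f\to X$. (5) The categories $\mathsf{LPA}$ and $\mathsf{PGA}$ are quasi-abelian. -/

import Mathlib

open CategoryTheory CategoryTheory.Limits Topology

universe v u

/-! ### The category of Hausdorff topological abelian groups -/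

/-- A Hausdorff topological abelian group (written additively). -/
structure HA : Type (u + 1) where
  /-- the underlying set -/
  carrier : Type u
  [addCommGroup : AddCommGroup carrier]
  [topologicalSpace : TopologicalSpace carrier]
  [isTopologicalAddGroup : IsTopologicalAddGroup carrier]
  [t2Space : T2Space carrier]

namespace HA

instance : CoeSort HA.{u} (Type u) := ⟨HA.carrier⟩

attribute [instance] HA.addCommGroup HA.topologicalSpace HA.isTopologicalAddGroup HA.t2Space

/-- A morphism of Hausdorff abelian groups is a continuous group homomorphism. -/
@[ext]
structure Hom (X Y : HA.{u}) : Type u where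
  /-- the underlying continuous group homomorphism -/
  toContHom : X →ₜ+ Y

instance : Category HA.{u} where
  Hom X Y := Hom X Y
  id X := ⟨ContinuousAddMonoidHom.id X⟩
  comp f g := ⟨g.toContHom.comp f.toContHom⟩

instance : ConcreteCategory HA.{u} (fun X Y => X →ₜ+ Y) where
  hom f := f.toContHom
  ofHom f := ⟨f⟩

/-- Morphisms of Hausdorff abelian groups are added pointwise. -/
instance (X Y : HA.{u}) : AddCommGroup (X ⟶ Y) :=
  Equiv.addCommGroup
    { toFun := fun f : Hom X Y => f.toContHom
      invFun := fun f => ⟨f⟩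
      left_inv := fun _ => rfl
      right_inv := fun _ => rfl }

instance : Preadditive HA.{u} where
  add_comp X Y Z f f' g := by
    apply Hom.ext
    ext x
    exact map_add g.toContHom (f.toContHom x) (f'.toContHom x)
  comp_add X Y Z f g g' := by
    apply Hom.ext
    ext x
    rfl

/-! ### Concrete subgroups, quotients, kernels and cokernels -/

/-- The subgroup `A` of `X`, with the subspace topology. -/
def sub (X : HA.{u}) (A : AddSubgroup X) : HA.{u} where
  carrier := A

/-- The inclusion `A → X` of a subgroup. -/
def subι (X : HA.{u}) (A : AddSubgroup X) : X.sub A ⟶ X :=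
  ⟨{ A.subtype with continuous_toFun := continuous_subtype_val }⟩

/-- The quotient `X / A` by a closed subgroup `A`, with the quotient topology. -/
def quot (X : HA.{u}) (A : AddSubgroup X) (hA : IsClosed (A : Set X)) : HA.{u} :=
  haveI := hA
  { carrier := X ⧸ A }

/-- The projection `X → X / A` to the quotient by a closed subgroup. -/
def quotπ (X : HA.{u}) (A : AddSubgroup X) (hA : IsClosed (A : Set X)) : X ⟶ X.quot A hA :=
  ⟨{ QuotientAddGroup.mk' A with continuous_toFun := QuotientAddGroup.continuous_mk }⟩

variable {X Y : HA.{u}}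

/-- The subgroup `{x ∈ X | f x = 0}` of `X`. -/
def kerSubgroup (f : X ⟶ Y) : AddSubgroup X := f.toContHom.toAddMonoidHom.ker

/-- The closure of the set-theoretic image `f(X)`, a subgroup of `Y`. -/
def closedRange (f : X ⟶ Y) : AddSubgroup Y :=
  f.toContHom.toAddMonoidHom.range.topologicalClosure

lemma isClosed_kerSubgroup (f : X ⟶ Y) : IsClosed (kerSubgroup f : Set X) :=
  isClosed_singleton.preimage f.toContHom.continuous_toFun

lemma isClosed_closedRange (f : X ⟶ Y) : IsClosed (closedRange f : Set Y) :=
  AddSubgroup.isClosed_topologicalClosure _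

/-- The group `ker f = {x ∈ X | f x = 0}`, with the subspace topology. -/
def ker (f : X ⟶ Y) : HA.{u} := X.sub (kerSubgroup f)

/-- The inclusion `ker f → X`. -/
def kerι (f : X ⟶ Y) : ker f ⟶ X := X.subι (kerSubgroup f)

/-- The group `coker f`, the quotient of `Y` by the closure of `f(X)`. -/
def coker (f : X ⟶ Y) : HA.{u} := Y.quot (closedRange f) (isClosed_closedRange f)

/-- The projection `Y → coker f`. -/
def cokerπ (f : X ⟶ Y) : Y ⟶ coker f := Y.quotπ (closedRange f) (isClosed_closedRange f)

/-- The closure of `f(X)` in `Y`, with the subspace topology. -/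
def im (f : X ⟶ Y) : HA.{u} := Y.sub (closedRange f)

/-- The inclusion of the closure of `f(X)` into `Y`. -/
def imι (f : X ⟶ Y) : im f ⟶ Y := Y.subι (closedRange f)

/-- The quotient group `X / ker f`, with the quotient topology. -/
def coim (f : X ⟶ Y) : HA.{u} := X.quot (kerSubgroup f) (isClosed_kerSubgroup f)

/-- The projection `X → X / ker f`. -/
def coimπ (f : X ⟶ Y) : X ⟶ coim f := X.quotπ (kerSubgroup f) (isClosed_kerSubgroup f)

/-- A sequence `X' → X → X''` is exact if it is a short exact sequence of the underlying abelian
groups, the first map is closed and the second map is open. -/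
structure IsExactSequence {X' X X'' : HA.{u}} (i : X' ⟶ X) (j : X ⟶ X'') : Prop where
  injective : Function.Injective i
  exact : Function.Exact i j
  surjective : Function.Surjective j
  isClosedMap : IsClosedMap i
  isOpenMap : IsOpenMap j

end HA

/-! ### Locally precompact and precompactly generated groups -/

section Precompact

variable {G : Type u} [AddCommGroup G] [TopologicalSpace G]

/-- A subset `S` of a topological abelian group is precompact if for every open neighbourhood `U`
of `0` finitely many translates `x + U` cover `S`. -/
def IsPrecompact (S : Set G) : Prop :=
  ∀ U : Set G, IsOpen U → (0 : G) ∈ U → ∃ F : Finset G, S ⊆ ⋃ x ∈ F, (fun y => x + y) '' U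

variable (G) in
/-- A topological abelian group is locally precompact if `0` has a precompact neighbourhood. -/
def IsLocallyPrecompact : Prop :=
  ∃ U ∈ 𝓝 (0 : G), IsPrecompact U

variable (G) in
/-- `0` has a precompact neighbourhood which generates the group as an abstract group. -/
def IsPrecompactlyGenerated : Prop :=
  ∃ U ∈ 𝓝 (0 : G), IsPrecompact U ∧ AddSubgroup.closure U = ⊤

end Precompact

/-- The property of being a locally precompact Hausdorff abelian group; the category `LPA` is the
full subcategory `LPA.FullSubcategory` of `HA`. -/
def LPA : ObjectProperty HA.{u} := fun X => IsLocallyPrecompact X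

/-- The property of being a locally precompact, precompactly generated Hausdorff abelian group;
the category `PGA` is the full subcategory `PGA.FullSubcategory` of `HA`. -/
def PGA : ObjectProperty HA.{u} := fun X => IsLocallyPrecompact X ∧ IsPrecompactlyGenerated X

/-! ### Kernels, cokernels and quasi-abelian categories -/

section QuasiAbelian

variable {C : Type u} [Category.{v} C] [Preadditive C]

/-- `i` is a kernel of `f` in the sense of category theory. -/
def IsKernelOf {K X Y : C} (i : K ⟶ X) (f : X ⟶ Y) : Prop :=
  ∃ w : i ≫ f = 0, Nonempty (IsLimit (KernelFork.ofι i w))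

/-- `p` is a cokernel of `f` in the sense of category theory. -/
def IsCokernelOf {X Y Q : C} (p : Y ⟶ Q) (f : X ⟶ Y) : Prop :=
  ∃ w : f ≫ p = 0, Nonempty (IsColimit (CokernelCofork.ofπ p w))

/-- A morphism is admissible (or strict) if the canonical morphism from its co-image
`coker (ker f → A)` to its image `ker (B → coker f)` is an isomorphism. -/
def IsAdmissible [HasKernels C] [HasCokernels C] {A B : C} (f : A ⟶ B) : Prop :=
  IsIso (Abelian.coimageImageComparison f)

variable (C) in
/-- A preadditive category is quasi-abelian if it is additive, has all kernels and cokernels,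
pushouts of admissible monics along arbitrary morphisms exist and are admissible monics, and
pullbacks of admissible epics along arbitrary morphisms exist and are admissible epics. -/
structure IsQuasiAbelian : Prop where
  [hasFiniteBiproducts : HasFiniteBiproducts C]
  [hasKernels : HasKernels C]
  [hasCokernels : HasCokernels C]
  hasPushout : ∀ {A B X : C} (f : A ⟶ B) (g : A ⟶ X), Mono f → IsAdmissible f → HasPushout f g
  pushout_admissible_mono : ∀ {A B X P : C} (f : A ⟶ B) (g : A ⟶ X) (g' : B ⟶ P) (f' : X ⟶ P),
    IsPushout f g g' f' → Mono f → IsAdmissible f → Mono f' ∧ IsAdmissible f'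
  hasPullback : ∀ {A B Y : C} (f : A ⟶ B) (g : Y ⟶ B), Epi f → IsAdmissible f → HasPullback f g
  pullback_admissible_epi : ∀ {A B Y P : C} (f : A ⟶ B) (g : Y ⟶ B) (g' : P ⟶ A) (f' : P ⟶ Y),
    IsPullback g' f' f g → Epi f → IsAdmissible f → Epi f' ∧ IsAdmissible f'

end QuasiAbelian

/-- The description of kernel, cokernel, image and co-image of a morphism `f : X ⟶ Y` in the full
subcategory of `HA` given by `P`: the concrete objects of `HA` lie in `P` and have the required
universal property in the subcategory; the kernel and cokernel also have it in `HA`. -/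
structure ComputedAsInHA (P : ObjectProperty HA.{u}) {X Y : P.FullSubcategory} (f : X ⟶ Y) :
    Prop where
  /-- `{x ∈ X | f x = 0}` lies in the subcategory -/
  ker_mem : P (HA.ker f.hom)
  ker_isKernel : IsKernelOf
    (ObjectProperty.homMk (HA.kerι f.hom) : (⟨HA.ker f.hom, ker_mem⟩ : P.FullSubcategory) ⟶ X) f
  ker_isKernel_HA : IsKernelOf (HA.kerι f.hom) f.hom
  kerι_injective : Function.Injective (HA.kerι f.hom)
  kerι_isClosedMap : IsClosedMap (HA.kerι f.hom)
  /-- the quotient of `Y` by the closure of `f(X)` lies in the subcategory -/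
  coker_mem : P (HA.coker f.hom)
  coker_isCokernel : IsCokernelOf
    (ObjectProperty.homMk (HA.cokerπ f.hom) :
      Y ⟶ (⟨HA.coker f.hom, coker_mem⟩ : P.FullSubcategory)) f
  coker_isCokernel_HA : IsCokernelOf (HA.cokerπ f.hom) f.hom
  cokerπ_surjective : Function.Surjective (HA.cokerπ f.hom)
  cokerπ_isOpenMap : IsOpenMap (HA.cokerπ f.hom)
  mono_iff_injective : Mono f ↔ Function.Injective f.hom
  mono_iff_ker_isZero : Mono f ↔ IsZero (⟨HA.ker f.hom, ker_mem⟩ : P.FullSubcategory)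
  /-- the category-theoretic image `ker (Y → coker f)` is the closure of `f(X)` -/
  im_mem : P (HA.im f.hom)
  im_isKernel : IsKernelOf
    (ObjectProperty.homMk (HA.imι f.hom) : (⟨HA.im f.hom, im_mem⟩ : P.FullSubcategory) ⟶ Y)
    (ObjectProperty.homMk (HA.cokerπ f.hom) :
      Y ⟶ (⟨HA.coker f.hom, coker_mem⟩ : P.FullSubcategory))
  epi_iff_denseRange : Epi f ↔ DenseRange f.hom
  epi_iff_coker_isZero : Epi f ↔ IsZero (⟨HA.coker f.hom, coker_mem⟩ : P.FullSubcategory)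
  /-- the category-theoretic co-image `coker (ker f → X)` is `X / ker f` -/
  coim_mem : P (HA.coim f.hom)
  coim_isCokernel : IsCokernelOf
    (ObjectProperty.homMk (HA.coimπ f.hom) :
      X ⟶ (⟨HA.coim f.hom, coim_mem⟩ : P.FullSubcategory))
    (ObjectProperty.homMk (HA.kerι f.hom) : (⟨HA.ker f.hom, ker_mem⟩ : P.FullSubcategory) ⟶ X)

/-!
Let `X` be precompactly generated by `U`, and `W = U ∪ -U`: an approximate subgroup generating `X`.
A cyclic subgroup either meets every set covered by finitely many translates of `W` in a finite set,
or is itself such a set; adding generators one at a time, `X` is a lattice `ℤᵐ` up to such a set.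
The lattice coordinate is a homomorphism up to a bounded error, so Hyers' argument replaces it by a
homomorphism `Φ : X → ℝᵐ` for which preimages of balls are precompact. A subgroup of `ℝᵐ` is
generated by its intersection with a ball, hence a subgroup `A` of `X` is generated by its
intersection with the preimage of a ball.

Categorically, a class of Hausdorff groups closed under closed subgroups, quotients by these, and
products computes kernels and cokernels as `HA` does. Its admissible monics are the closed
embeddings and its admissible epics the open surjections, and both survive pushout and pullback,
which are a quotient and a subgroup of a product.
-/

section Covering

open scoped Pointwise

/-- `S` is covered by finitely many translates of `W`. This is `CovByVAdd` with an unspecified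
number of translates; precompactness of `S` is the case of all neighbourhoods `W` of `0`. -/
def FinitelyCoveredBy {M : Type*} [Add M] (S W : Set M) : Prop :=
  ∃ F : Set M, F.Finite ∧ S ⊆ F + W

namespace FinitelyCoveredBy

section Monoid

variable {M N : Type*} [AddCommMonoid M] [AddCommMonoid N] {S S' T W W' : Set M}

lemma refl (W : Set M) : FinitelyCoveredBy W W :=
  ⟨{0}, Set.finite_singleton 0, by simp⟩

lemma of_finite (hS : S.Finite) (hW : 0 ∈ W) : FinitelyCoveredBy S W :=
  ⟨S, hS, Set.subset_add_left S hW⟩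

lemma subset_left (h : FinitelyCoveredBy T W) (hST : S ⊆ T) : FinitelyCoveredBy S W :=
  let ⟨F, hF, hT⟩ := h
  ⟨F, hF, hST.trans hT⟩

lemma subset_right (h : FinitelyCoveredBy S W) (hW : W ⊆ W') : FinitelyCoveredBy S W' :=
  let ⟨F, hF, hS⟩ := h
  ⟨F, hF, hS.trans (Set.add_subset_add_left hW)⟩

lemma finite (h : FinitelyCoveredBy S W) (hW : W.Finite) : S.Finite :=
  let ⟨_, hF, hS⟩ := h
  (hF.add hW).subset hS

lemma union (hS : FinitelyCoveredBy S W) (hT : FinitelyCoveredBy T W) :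
    FinitelyCoveredBy (S ∪ T) W := by
  obtain ⟨F, hF, hS⟩ := hS
  obtain ⟨F', hF', hT⟩ := hT
  refine ⟨F ∪ F', hF.union hF', ?_⟩
  rw [Set.union_add]
  exact Set.union_subset_union hS hT

lemma add (hS : FinitelyCoveredBy S W) (hT : FinitelyCoveredBy T W') :
    FinitelyCoveredBy (S + T) (W + W') := by
  obtain ⟨F, hF, hS⟩ := hS
  obtain ⟨F', hF', hT⟩ := hT
  refine ⟨F + F', hF.add hF', ?_⟩
  rw [add_add_add_comm]
  exact Set.add_subset_add hS hT

lemma trans (hS : FinitelyCoveredBy S T) (hT : FinitelyCoveredBy T W) :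
    FinitelyCoveredBy S W := by
  obtain ⟨F, hF, hS⟩ := hS
  obtain ⟨F', hF', hT⟩ := hT
  refine ⟨F + F', hF.add hF', hS.trans ?_⟩
  rw [add_assoc]
  exact Set.add_subset_add_left hT

lemma image (h : FinitelyCoveredBy S W) (φ : M →+ N) : FinitelyCoveredBy (φ '' S) (φ '' W) := by
  obtain ⟨F, hF, hS⟩ := h
  refine ⟨φ '' F, hF.image φ, ?_⟩
  rw [← Set.image_add]
  exact Set.image_mono hS

lemma prod {P Q : Set N} (hS : FinitelyCoveredBy S W) (hP : FinitelyCoveredBy P Q) :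
    FinitelyCoveredBy (S ×ˢ P) (W ×ˢ Q) := by
  obtain ⟨F, hF, hS⟩ := hS
  obtain ⟨F', hF', hP⟩ := hP
  refine ⟨F ×ˢ F', hF.prod hF', ?_⟩
  rw [Set.prod_add_prod_comm]
  exact Set.prod_mono hS hP

lemma exists_subset_image {φ : M →+ N} (hφ : Function.Surjective φ) {P : Set N}
    (h : FinitelyCoveredBy P (φ '' W)) : ∃ T, FinitelyCoveredBy T W ∧ P ⊆ φ '' T := by
  obtain ⟨F, hF, hP⟩ := h
  refine ⟨Function.surjInv hφ '' F + W, ⟨_, hF.image _, subset_rfl⟩, ?_⟩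
  rwa [Set.image_add, (Function.rightInverse_surjInv hφ).image_image]

end Monoid

variable {G H : Type*} [AddCommGroup G] [AddCommGroup H] {S T W : Set G} {K : ℝ}

lemma preimage (h : FinitelyCoveredBy S W) (φ : H →+ G) :
    FinitelyCoveredBy (φ ⁻¹' S) (φ ⁻¹' (W - W)) := by
  obtain ⟨F, hF, hS⟩ := h
  have hex : ∀ f : G, (∃ y, φ y - f ∈ W) → ∃ y, φ y - f ∈ W := fun _ => id
  choose! c hc using hex
  refine ⟨c '' F, hF.image c, fun y hy => ?_⟩
  obtain ⟨f, hf, w, hw, hfw⟩ := hS hy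
  have hyf : φ y - f ∈ W := by rwa [← hfw, add_sub_cancel_left]
  refine ⟨c f, ⟨f, hf, rfl⟩, y - c f, ?_, add_sub_cancel _ _⟩
  rw [Set.mem_preimage, map_sub, ← sub_sub_sub_cancel_right _ _ f]
  exact Set.sub_mem_sub hyf (hc f ⟨y, hyf⟩)

lemma add_of_isApproximate (hW : IsApproximateAddSubgroup K W) (hS : FinitelyCoveredBy S W)
    (hT : FinitelyCoveredBy T W) : FinitelyCoveredBy (S + T) W := by
  obtain ⟨F, -, hF⟩ := hW.two_nsmul_covByVAdd
  rw [two_nsmul, vadd_eq_add] at hF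
  exact (hS.add hT).trans ⟨F, F.finite_toSet, hF⟩

lemma sub_of_isApproximate (hW : IsApproximateAddSubgroup K W) (hS : FinitelyCoveredBy S W)
    (hT : FinitelyCoveredBy T W) : FinitelyCoveredBy (S - T) W := by
  have hnegT := hT.image (negAddMonoidHom : G →+ G)
  simp only [coe_negAddMonoidHom, Set.image_neg_eq_neg, hW.neg_eq_self] at hnegT
  rw [sub_eq_add_neg]
  exact hS.add_of_isApproximate hW hnegT

end FinitelyCoveredBy

section ApproximateSubgroup

variable {G H : Type*} [AddCommGroup G] [AddCommGroup H] {V W : Set G} {K : ℝ}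

lemma exists_isApproximateAddSubgroup_of_finitelyCoveredBy (h0 : 0 ∈ V) (hneg : -V = V)
    (hadd : FinitelyCoveredBy (V + V) V) : ∃ K, IsApproximateAddSubgroup K V := by
  obtain ⟨F, hF, hVF⟩ := hadd
  lift F to Finset G using hF
  exact ⟨F.card, h0, hneg, F, le_rfl, by rwa [two_nsmul, vadd_eq_add]⟩

lemma exists_isApproximateAddSubgroup_preimage_sub (hW : IsApproximateAddSubgroup K W)
    (φ : H →+ G) : ∃ K', IsApproximateAddSubgroup K' (φ ⁻¹' (W - W)) := by
  refine exists_isApproximateAddSubgroup_of_finitelyCoveredBy ?_ ?_ ?_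
  · exact ⟨0, hW.zero_mem, 0, hW.zero_mem, by simp⟩
  · ext y
    rw [Set.mem_neg, Set.mem_preimage, map_neg, ← Set.mem_neg, neg_sub, Set.mem_preimage]
  · have hWW := (FinitelyCoveredBy.refl W).sub_of_isApproximate hW (.refl W)
    refine ((hWW.add_of_isApproximate hW hWW).preimage φ).subset_left ?_
    rintro _ ⟨y, hy, z, hz, rfl⟩
    exact ⟨φ y, hy, φ z, hz, (map_add φ y z).symm⟩

end ApproximateSubgroup

end Covering

section Lattice

open scoped Pointwise

variable {G H : Type*} [AddCommGroup G] [AddCommGroup H] {W : Set G} {K : ℝ}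

lemma exists_bounded_step_of_infinite {V : Set ℤ} (hV : IsApproximateAddSubgroup K V)
    (hinf : V.Infinite) : ∃ L : ℤ, ∀ v ∈ V, ∃ l ∈ Set.Icc 1 L, v + l ∈ V := by
  obtain ⟨F, hF, hVF⟩ := (FinitelyCoveredBy.refl V).add_of_isApproximate hV (.refl V)
  obtain ⟨B, hB⟩ := (hF.image abs).bddAbove
  obtain ⟨m, hm, hBm⟩ : ∃ m ∈ V, B < m := by
    obtain ⟨m, hm, hBm⟩ := hinf.exists_notMem_finset (Finset.Icc (-B) B)
    rw [Finset.mem_Icc, ← abs_le, not_le, lt_abs] at hBm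
    rcases hBm with hBm | hBm
    · exact ⟨m, hm, hBm⟩
    · exact ⟨-m, by rwa [← Set.mem_neg, hV.neg_eq_self], hBm⟩
  -- `v + m` differs from a point of `V` by an element of `F`, and `m` exceeds all of these.
  refine ⟨m + B, fun v hv => ?_⟩
  obtain ⟨f, hf, w, hw, hfw⟩ := hVF (Set.add_mem_add hv hm)
  have hfB := abs_le.1 (hB ⟨f, hf, rfl⟩)
  refine ⟨m - f, ⟨by lia, by lia⟩, ?_⟩
  rwa [show v + (m - f) = w by linarith [hfw]]

lemma finitelyCoveredBy_univ_of_infinite {V : Set ℤ} (hV : IsApproximateAddSubgroup K V)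
    (hinf : V.Infinite) : FinitelyCoveredBy Set.univ V := by
  obtain ⟨L, hL⟩ := exists_bounded_step_of_infinite hV hinf
  have hdown : ∀ v ∈ V, ∃ l ∈ Set.Icc 1 L, v - l ∈ V := fun v hv => by
    obtain ⟨l, hl, hvl⟩ := hL (-v) (by rwa [← Set.mem_neg, hV.neg_eq_self])
    refine ⟨l, hl, ?_⟩
    rwa [← hV.neg_eq_self, Set.mem_neg, neg_sub', sub_neg_eq_add]
  have hnear : ∀ n : ℤ, ∃ t ∈ V, n - t ∈ Set.Icc (-L) L := fun n => by
    induction n with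
    | zero =>
      obtain ⟨l, hl, -⟩ := hL 0 hV.zero_mem
      exact ⟨0, hV.zero_mem, by grind⟩
    | succ n ih =>
      obtain ⟨t, ht, hnt⟩ := ih
      obtain ⟨l, hl, htl⟩ := hL t ht
      by_cases h : n + 1 - t ≤ L
      · exact ⟨t, ht, by grind⟩
      · exact ⟨t + l, htl, by grind⟩
    | pred n ih =>
      obtain ⟨t, ht, hnt⟩ := ih
      obtain ⟨l, hl, htl⟩ := hdown t ht
      by_cases h : -L ≤ -n - 1 - t
      · exact ⟨t, ht, by grind⟩
      · exact ⟨t - l, htl, by grind⟩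
  refine ⟨Set.Icc (-L) L, Set.finite_Icc _ _, fun n _ => ?_⟩
  obtain ⟨t, ht, hnt⟩ := hnear n
  exact ⟨n - t, hnt, t, ht, sub_add_cancel n t⟩

/-- The discrete analogue of a proper map: the sets covered by finitely many translates of `W` play
the role of the relatively compact ones. For `H = ℤᵐ` such a map parametrizes a lattice in `G`. -/
def IsCoarselyProper (ψ : H →+ G) (W : Set G) : Prop :=
  ∀ T, FinitelyCoveredBy T W → (ψ ⁻¹' T).Finite

lemma isCoarselyProper_or_finitelyCoveredBy_zmultiples (hW : IsApproximateAddSubgroup K W)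
    (x : G) : IsCoarselyProper (zmultiplesHom G x) W ∨
      FinitelyCoveredBy (AddSubgroup.zmultiples x : Set G) W := by
  rw [or_iff_not_imp_left, IsCoarselyProper]
  push Not
  rintro ⟨S, hS, hSinf⟩
  obtain ⟨K', hV⟩ := exists_isApproximateAddSubgroup_preimage_sub hW (zmultiplesHom G x)
  have hVinf := fun hfin => hSinf ((hS.preimage (zmultiplesHom G x)).finite hfin)
  have hcov := (finitelyCoveredBy_univ_of_infinite hV hVinf).image (zmultiplesHom G x)
  rw [Set.image_univ, ← AddMonoidHom.coe_range, AddSubgroup.range_zmultiplesHom] at hcov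
  exact (hcov.subset_right (Set.image_preimage_subset _ _)).trans
    ((FinitelyCoveredBy.refl W).sub_of_isApproximate hW (.refl W))

/-- Apply the dichotomy for `zmultiples` to the image of `x` in `G ⧸ ψ.range`. -/
lemma IsCoarselyProper.coprod_or_exists_zmultiples_subset {ψ : H →+ G}
    (hψ : IsCoarselyProper ψ W) (hW : IsApproximateAddSubgroup K W) (x : G) :
    IsCoarselyProper ((zmultiplesHom G x).coprod ψ) W ∨
      ∃ S, FinitelyCoveredBy S W ∧ (AddSubgroup.zmultiples x : Set G) ⊆ ψ.range + S := by
  let π := QuotientAddGroup.mk' ψ.range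
  have hπψ : ∀ h, π (ψ h) = 0 := fun h => (QuotientAddGroup.eq_zero_iff _).2 ⟨h, rfl⟩
  rcases isCoarselyProper_or_finitelyCoveredBy_zmultiples (hW.image π) (π x) with hfin | hcov
  · refine .inl fun T hT => .of_finite_fibers Prod.fst ((hfin _ (hT.image π)).subset ?_) ?_
    · rintro _ ⟨⟨k, h⟩, hkh, rfl⟩
      exact ⟨_, hkh, by simp [hπψ]⟩
    · rintro k -
      have hTk : FinitelyCoveredBy (T - {k • x}) W :=
        hT.sub_of_isApproximate hW (.of_finite (Set.finite_singleton _) hW.zero_mem)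
      refine ((hψ _ hTk).image (Prod.mk k)).subset ?_
      rintro ⟨k', h⟩ ⟨hkh, rfl⟩
      exact ⟨h, ⟨_, hkh, _, rfl, by simp⟩, rfl⟩
  · obtain ⟨S, hS, hsub⟩ := hcov.exists_subset_image (QuotientAddGroup.mk'_surjective _)
    refine .inr ⟨S, hS, fun y hy => ?_⟩
    obtain ⟨s, hs, hsy⟩ : π y ∈ π '' S := by
      refine hsub ?_
      obtain ⟨k, rfl⟩ := hy
      exact ⟨k, (map_zsmul π k x).symm⟩
    refine ⟨y - s, ?_, s, hs, sub_add_cancel y s⟩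
    rw [SetLike.mem_coe, ← QuotientAddGroup.eq_zero_iff]
    exact (map_sub π y s).trans (sub_eq_zero.2 hsy.symm)

lemma exists_isCoarselyProper_of_finite (hW : IsApproximateAddSubgroup K W) {s : Set G}
    (hs : s.Finite) : ∃ (m : ℕ) (ψ : (Fin m → ℤ) →+ G), IsCoarselyProper ψ W ∧
      ∃ S, FinitelyCoveredBy S W ∧ (AddSubgroup.closure s : Set G) ⊆ ψ.range + S := by
  induction s, hs using Set.Finite.induction_on with
  | empty =>
    refine ⟨0, 0, fun _ _ => Set.toFinite _, {0},
      .of_finite (Set.finite_singleton 0) hW.zero_mem, ?_⟩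
    simp [AddSubgroup.closure_empty]
  | @insert x s _ _ ih =>
    obtain ⟨m, ψ, hψ, S, hS, hsub⟩ := ih
    have hinsert : (AddSubgroup.closure (insert x s) : Set G) ⊆
        AddSubgroup.zmultiples x + (ψ.range + S) := by
      rw [Set.insert_eq, AddSubgroup.closure_union, AddSubgroup.zmultiples_eq_closure,
        AddSubgroup.add_normal]
      exact Set.add_subset_add_left hsub
    rcases hψ.coprod_or_exists_zmultiples_subset hW x with hproper | ⟨S', hS', hsub'⟩
    · let e := (Fin.consLinearEquiv ℤ fun _ : Fin (m + 1) => ℤ).toAddEquiv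
      refine ⟨m + 1, ((zmultiplesHom G x).coprod ψ).comp e.symm.toAddMonoidHom, fun T hT => ?_,
        S, hS, hinsert.trans ?_⟩
      · rw [AddMonoidHom.coe_comp, Set.preimage_comp]
        exact (hproper T hT).preimage e.symm.injective.injOn
      · rintro _ ⟨_, ⟨k, rfl⟩, _, ⟨_, ⟨z, rfl⟩, t, ht, rfl⟩, rfl⟩
        exact ⟨_, ⟨e (k, z), rfl⟩, t, ht, by simp [add_assoc]⟩
    · refine ⟨m, ψ, hψ, S' + S, hS'.add_of_isApproximate hW hS, hinsert.trans ?_⟩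
      calc (AddSubgroup.zmultiples x + (ψ.range + S) : Set G)
          ⊆ (ψ.range + S') + (ψ.range + S) := Set.add_subset_add_right hsub'
        _ = (ψ.range + ψ.range) + (S' + S) := add_add_add_comm _ _ _ _
        _ = ψ.range + (S' + S) := by rw [coe_add_coe]

lemma closure_subset_closure_add {F : Set G} (hW : IsApproximateAddSubgroup K W)
    (hWF : W + W ⊆ F + W) : (AddSubgroup.closure W : Set G) ⊆ AddSubgroup.closure F + W := by
  intro g hg
  induction hg using AddSubgroup.closure_induction with
  | mem w hw => exact ⟨0, zero_mem _, w, hw, zero_add w⟩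
  | zero => exact ⟨0, zero_mem _, 0, hW.zero_mem, zero_add 0⟩
  | add _ _ _ _ hg hg' =>
    obtain ⟨a, ha, w, hw, rfl⟩ := hg
    obtain ⟨a', ha', w', hw', rfl⟩ := hg'
    obtain ⟨f, hf, v, hv, hfv⟩ := hWF (Set.add_mem_add hw hw')
    refine ⟨a + a' + f, add_mem (add_mem ha ha') (AddSubgroup.subset_closure hf), v, hv, ?_⟩
    simp only at hfv ⊢
    rw [add_assoc, hfv, add_add_add_comm]
  | neg _ _ hg =>
    obtain ⟨a, ha, w, hw, rfl⟩ := hg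
    refine ⟨-a, neg_mem ha, -w, ?_, (neg_add a w).symm⟩
    rwa [← Set.mem_neg, hW.neg_eq_self]

lemma exists_isCoarselyProper_range_add_eq_univ (hW : IsApproximateAddSubgroup K W)
    (hgen : AddSubgroup.closure W = ⊤) : ∃ (m : ℕ) (ψ : (Fin m → ℤ) →+ G),
      IsCoarselyProper ψ W ∧ ∃ S, FinitelyCoveredBy S W ∧ (ψ.range + S : Set G) = Set.univ := by
  obtain ⟨F, hF, hWF⟩ := (FinitelyCoveredBy.refl W).add_of_isApproximate hW (.refl W)
  obtain ⟨m, ψ, hψ, S, hS, hsub⟩ := exists_isCoarselyProper_of_finite hW hF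
  refine ⟨m, ψ, hψ, S + W, hS.add_of_isApproximate hW (.refl W), Set.univ_subset_iff.1 ?_⟩
  calc Set.univ = (AddSubgroup.closure W : Set G) := by rw [hgen, AddSubgroup.coe_top]
    _ ⊆ AddSubgroup.closure F + W := closure_subset_closure_add hW hWF
    _ ⊆ (ψ.range + S) + W := Set.add_subset_add_right hsub
    _ = ψ.range + (S + W) := add_assoc _ _ _

end Lattice

section RealVectorSpaces

variable {E : Type*} [NormedAddCommGroup E] [NormedSpace ℝ E]

/-- Hyers' argument: `φ a` is the limit of `q (2 ^ k • a) / 2 ^ k`. -/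
lemma exists_addMonoidHom_near_of_norm_map_add_sub_le [CompleteSpace E] {M : Type*}
    [AddCommMonoid M] (q : M → E) {C : ℝ} (hq : ∀ a b, ‖q (a + b) - q a - q b‖ ≤ C) :
    ∃ φ : M →+ E, ∀ a, ‖φ a - q a‖ ≤ C := by
  let u : M → ℕ → E := fun a k => ((2 : ℝ) ^ k)⁻¹ • q (2 ^ k • a)
  have hu : ∀ a k, dist (u a k) (u a (k + 1)) ≤ C / 2 / 2 ^ k := fun a k => by
    have hstep : u a (k + 1) - u a k =
        ((2 : ℝ) ^ (k + 1))⁻¹ • (q (2 ^ k • a + 2 ^ k • a) - q (2 ^ k • a) - q (2 ^ k • a)) := by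
      have htwo : ((2 : ℝ) ^ k)⁻¹ = ((2 : ℝ) ^ (k + 1))⁻¹ + ((2 : ℝ) ^ (k + 1))⁻¹ := by
        field_simp
        ring
      have hdouble : 2 ^ (k + 1) • a = 2 ^ k • a + 2 ^ k • a := by
        rw [← add_smul, ← mul_two, pow_succ]
      simp only [u]
      rw [hdouble, htwo]
      module
    rw [dist_comm, dist_eq_norm, hstep, norm_smul, norm_inv, norm_pow, Real.norm_ofNat, div_div,
      ← pow_succ', inv_mul_eq_div]
    gcongr
    exact hq _ _
  choose φ hφ using fun a => cauchySeq_tendsto_of_complete (cauchySeq_of_le_geometric_two (hu a))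
  have hadd : ∀ a b, φ (a + b) - φ a - φ b = 0 := fun a b => by
    refine tendsto_nhds_unique (((hφ (a + b)).sub (hφ a)).sub (hφ b)) ?_
    refine squeeze_zero_norm (a := fun k : ℕ => C / 2 ^ k) (fun k => ?_) ?_
    · simp only [u]
      rw [smul_add, ← smul_sub, ← smul_sub, norm_smul, norm_inv, norm_pow, Real.norm_ofNat,
        inv_mul_eq_div]
      gcongr
      exact hq _ _
    · exact tendsto_const_nhds.div_atTop (tendsto_pow_atTop_atTop_of_one_lt one_lt_two)
  refine ⟨AddMonoidHom.mk' φ fun a b => ?_, fun a => ?_⟩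
  · rw [← sub_eq_zero, ← sub_sub, hadd]
  · have hdist := dist_le_of_le_geometric_two_of_tendsto₀ (hu a) (hφ a)
    rw [dist_comm, dist_eq_norm] at hdist
    simpa [u] using hdist

lemma exists_le_closure_inter_closedBall [FiniteDimensional ℝ E] (A : AddSubgroup E) :
    ∃ R : ℝ, 0 ≤ R ∧ A ≤ AddSubgroup.closure (A ∩ Metric.closedBall 0 R) := by
  obtain ⟨s, hsA, hs⟩ := Submodule.fg_span_iff_fg_span_finset_subset (A : Set E) |>.1
    (IsNoetherian.noetherian (Submodule.span ℝ (A : Set E)))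
  have hball : ∀ x ∈ A, ‖x‖ ≤ ∑ i ∈ s, ‖i‖ →
      x ∈ AddSubgroup.closure (A ∩ Metric.closedBall 0 (∑ i ∈ s, ‖i‖)) := fun x hx hxs =>
    AddSubgroup.subset_closure ⟨hx, mem_closedBall_zero_iff.2 hxs⟩
  refine ⟨∑ i ∈ s, ‖i‖, Finset.sum_nonneg fun i _ => norm_nonneg i, fun a ha => ?_⟩
  obtain ⟨c, -, rfl⟩ := Submodule.mem_span_finset.1 (hs ▸ Submodule.subset_span ha)
  have hsplit : ∑ i ∈ s, c i • i = ∑ i ∈ s, ⌊c i⌋ • i + ∑ i ∈ s, Int.fract (c i) • i := by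
    rw [← Finset.sum_add_distrib]
    refine Finset.sum_congr rfl fun i _ => ?_
    rw [← Int.cast_smul_eq_zsmul ℝ, ← add_smul, Int.floor_add_fract]
  have hfloor : ∑ i ∈ s, ⌊c i⌋ • i ∈ A := sum_mem fun i hi => zsmul_mem (hsA hi) _
  rw [hsplit] at ha ⊢
  refine add_mem (sum_mem fun i hi => zsmul_mem (hball i (hsA hi) ?_) _)
    (hball _ ((add_mem_cancel_left hfloor).1 ha) (norm_sum_le_of_le _ fun i _ => ?_))
  · exact Finset.single_le_sum (f := fun i => ‖i‖) (fun i _ => norm_nonneg i) hi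
  · rw [norm_smul, Real.norm_eq_abs, Int.abs_fract]
    exact mul_le_of_le_one_left (norm_nonneg i) (Int.fract_lt_one _).le

end RealVectorSpaces

section Coordinates

open scoped Pointwise

variable {G : Type*} [AddCommGroup G] {W : Set G} {K : ℝ}

lemma pi_norm_intCast {ι : Type*} [Fintype ι] (z : ι → ℤ) : ‖fun i => (z i : ℝ)‖ = ‖z‖ := by
  simp only [Pi.norm_def, nnnorm, Int.norm_cast_real]

/-- Any choice of lattice coordinate modulo `S` is additive up to a bounded error. -/
lemma IsCoarselyProper.exists_addMonoidHom_real {m : ℕ} {ψ : (Fin m → ℤ) →+ G} {S : Set G}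
    (hψ : IsCoarselyProper ψ W) (hW : IsApproximateAddSubgroup K W) (hS : FinitelyCoveredBy S W)
    (hψS : (ψ.range + S : Set G) = Set.univ) :
    ∃ Φ : G →+ (Fin m → ℝ), ∀ R, FinitelyCoveredBy (Φ ⁻¹' Metric.closedBall 0 R) W := by
  have hcoord : ∀ g, ∃ z : Fin m → ℤ, g - ψ z ∈ S := fun g => by
    obtain ⟨_, ⟨z, rfl⟩, s, hs, rfl⟩ : g ∈ (ψ.range + S : Set G) := hψS ▸ Set.mem_univ g
    exact ⟨z, by rwa [add_sub_cancel_left]⟩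
  choose q hq using hcoord
  have hdefect : FinitelyCoveredBy (S + S - S) W :=
    (hS.add_of_isApproximate hW hS).sub_of_isApproximate hW hS
  obtain ⟨C, hC⟩ := ((hψ _ hdefect).image norm).bddAbove
  have hqC : ∀ a b, ‖q (a + b) - q a - q b‖ ≤ C := fun a b => by
    refine hC ⟨_, ?_, rfl⟩
    refine ⟨_, Set.add_mem_add (hq a) (hq b), _, hq (a + b), ?_⟩
    simp only [map_sub]
    abel
  obtain ⟨Φ, hΦ⟩ := exists_addMonoidHom_near_of_norm_map_add_sub_le
    (fun g i => (q g i : ℝ)) (C := C) fun a b => by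
      refine le_of_eq_of_le ?_ (hqC a b)
      rw [← pi_norm_intCast]
      congr 1
      ext i
      simp
  refine ⟨Φ, fun R => ?_⟩
  have hball : (Metric.closedBall (0 : Fin m → ℤ) (R + C)).Finite :=
    (isCompact_closedBall _ _).finite_of_discrete
  refine ((FinitelyCoveredBy.of_finite (hball.image ψ) hW.zero_mem).add_of_isApproximate
    hW hS).subset_left fun a ha => ⟨ψ (q a), ⟨q a, ?_, rfl⟩, _, hq a, add_sub_cancel _ _⟩
  rw [Set.mem_preimage, mem_closedBall_zero_iff] at ha
  rw [mem_closedBall_zero_iff, ← pi_norm_intCast]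
  have htri := norm_le_norm_add_norm_sub (Φ a) fun i => (q a i : ℝ)
  linarith [hΦ a]

lemma exists_finitelyCoveredBy_le_closure (hW : IsApproximateAddSubgroup K W)
    (hgen : AddSubgroup.closure W = ⊤) (A : AddSubgroup G) :
    ∃ T, FinitelyCoveredBy T W ∧ A ≤ AddSubgroup.closure (A ∩ T) := by
  obtain ⟨m, ψ, hψ, S, hS, hψS⟩ := exists_isCoarselyProper_range_add_eq_univ hW hgen
  obtain ⟨Φ, hΦ⟩ := hψ.exists_addMonoidHom_real hW hS hψS
  obtain ⟨R, hR, hA⟩ := exists_le_closure_inter_closedBall (A.map Φ)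
  refine ⟨Φ ⁻¹' Metric.closedBall 0 R, hΦ R, fun a ha => ?_⟩
  rw [AddSubgroup.coe_map, ← Set.image_inter_preimage, ← AddMonoidHom.map_closure] at hA
  obtain ⟨b, hb, hba⟩ := hA (AddSubgroup.mem_map_of_mem Φ ha)
  have hbA : b ∈ A := (AddSubgroup.closure_le A).2 Set.inter_subset_left hb
  have hker : Φ (a - b) = 0 := by rw [map_sub, hba, sub_self]
  rw [← sub_add_cancel a b]
  refine add_mem (AddSubgroup.subset_closure ⟨sub_mem ha hbA, ?_⟩) hb
  rw [Set.mem_preimage, hker]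
  exact Metric.mem_closedBall_self hR

end Coordinates

section Precompact

open scoped Pointwise

variable {G H : Type u} [AddCommGroup G] [TopologicalSpace G] [AddCommGroup H] [TopologicalSpace H]
  {S T : Set G}

lemma isPrecompact_iff : IsPrecompact S ↔ ∀ U ∈ 𝓝 (0 : G), FinitelyCoveredBy S U := by
  have hadd : ∀ F U : Set G, ⋃ x ∈ F, (fun y => x + y) '' U = F + U :=
    fun F U => Set.iUnion_image_left (· + ·)
  refine ⟨fun h U hU => ?_, fun h U hU h0 => ?_⟩
  · obtain ⟨F, hF⟩ := h (interior U) isOpen_interior (mem_interior_iff_mem_nhds.2 hU)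
    refine ⟨F, F.finite_toSet, hF.trans ?_⟩
    exact (hadd F (interior U)).subset.trans (Set.add_subset_add_left interior_subset)
  · obtain ⟨F, hF, hS⟩ := h U (hU.mem_nhds h0)
    lift F to Finset G using hF
    exact ⟨F, hS.trans (hadd F U).superset⟩

namespace IsPrecompact

lemma mono (hT : IsPrecompact T) (h : S ⊆ T) : IsPrecompact S :=
  isPrecompact_iff.2 fun U hU => (isPrecompact_iff.1 hT U hU).subset_left h

lemma union (hS : IsPrecompact S) (hT : IsPrecompact T) : IsPrecompact (S ∪ T) :=
  isPrecompact_iff.2 fun U hU => (isPrecompact_iff.1 hS U hU).union (isPrecompact_iff.1 hT U hU)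

lemma of_finite (hS : S.Finite) : IsPrecompact S :=
  isPrecompact_iff.2 fun _ hU => .of_finite hS (mem_of_mem_nhds hU)

lemma image (hS : IsPrecompact S) (f : G →+ H) (hf : Continuous f) : IsPrecompact (f '' S) := by
  refine isPrecompact_iff.2 fun U hU => ?_
  have hV : f ⁻¹' U ∈ 𝓝 0 := hf.continuousAt (by rwa [map_zero])
  exact ((isPrecompact_iff.1 hS _ hV).image f).subset_right (Set.image_preimage_subset f U)

lemma neg [IsTopologicalAddGroup G] (hS : IsPrecompact S) : IsPrecompact (-S) := by
  simpa using hS.image (negAddMonoidHom : G →+ G) continuous_neg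

lemma add [IsTopologicalAddGroup G] (hS : IsPrecompact S) (hT : IsPrecompact T) :
    IsPrecompact (S + T) := by
  refine isPrecompact_iff.2 fun U hU => ?_
  obtain ⟨V, hVo, hV0, hVU⟩ := exists_open_nhds_zero_add_subset hU
  have hV := hVo.mem_nhds hV0
  exact ((isPrecompact_iff.1 hS V hV).add (isPrecompact_iff.1 hT V hV)).subset_right hVU

lemma of_finitelyCoveredBy [IsTopologicalAddGroup G] (hT : IsPrecompact T)
    (h : FinitelyCoveredBy S T) : IsPrecompact S :=
  let ⟨_, hF, hS⟩ := h
  ((of_finite hF).add hT).mono hS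

lemma preimage [IsTopologicalAddGroup G] (hS : IsPrecompact S) (f : H →+ G) (hf : IsInducing f) :
    IsPrecompact (f ⁻¹' S) := by
  refine isPrecompact_iff.2 fun U hU => ?_
  rw [hf.nhds_eq_comap, map_zero] at hU
  obtain ⟨U', hU', hUU'⟩ := hU
  obtain ⟨V, hV, hVU'⟩ := exists_nhds_half_neg hU'
  refine ((isPrecompact_iff.1 hS V hV).preimage f).subset_right
    ((Set.preimage_mono ?_).trans hUU')
  exact Set.sub_subset_iff.2 hVU'

lemma prod {S' : Set H} (hS : IsPrecompact S) (hS' : IsPrecompact S') :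
    IsPrecompact (S ×ˢ S') := by
  refine isPrecompact_iff.2 fun U hU => ?_
  rw [Prod.zero_eq_mk, nhds_prod_eq, Filter.mem_prod_iff] at hU
  obtain ⟨V, hV, V', hV', hVU⟩ := hU
  exact ((isPrecompact_iff.1 hS V hV).prod (isPrecompact_iff.1 hS' V' hV')).subset_right hVU

end IsPrecompact

namespace IsLocallyPrecompact

lemma of_isInducing [IsTopologicalAddGroup G] (hG : IsLocallyPrecompact G) (f : H →+ G)
    (hf : IsInducing f) : IsLocallyPrecompact H := by
  obtain ⟨U, hU, hUc⟩ := hG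
  exact ⟨f ⁻¹' U, hf.continuous.continuousAt (by rwa [map_zero]), hUc.preimage f hf⟩

lemma of_isOpenMap (hG : IsLocallyPrecompact G) (f : G →+ H) (hf : Continuous f)
    (hfo : IsOpenMap f) : IsLocallyPrecompact H := by
  obtain ⟨U, hU, hUc⟩ := hG
  exact ⟨f '' U, map_zero f ▸ hfo.image_mem_nhds hU, hUc.image f hf⟩

lemma prod (hG : IsLocallyPrecompact G) (hH : IsLocallyPrecompact H) :
    IsLocallyPrecompact (G × H) := by
  obtain ⟨U, hU, hUc⟩ := hG
  obtain ⟨V, hV, hVc⟩ := hH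
  exact ⟨U ×ˢ V, prod_mem_nhds hU hV, hUc.prod hVc⟩

end IsLocallyPrecompact

namespace IsPrecompactlyGenerated

lemma isLocallyPrecompact (hG : IsPrecompactlyGenerated G) : IsLocallyPrecompact G :=
  let ⟨U, hU, hUc, _⟩ := hG
  ⟨U, hU, hUc⟩

lemma of_isOpenMap (hG : IsPrecompactlyGenerated G) (f : G →+ H) (hf : Continuous f)
    (hfo : IsOpenMap f) (hfs : Function.Surjective f) : IsPrecompactlyGenerated H := by
  obtain ⟨U, hU, hUc, hgen⟩ := hG
  refine ⟨f '' U, map_zero f ▸ hfo.image_mem_nhds hU, hUc.image f hf, ?_⟩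
  rw [← AddMonoidHom.map_closure, hgen, AddSubgroup.map_top_of_surjective f hfs]

lemma prod (hG : IsPrecompactlyGenerated G) (hH : IsPrecompactlyGenerated H) :
    IsPrecompactlyGenerated (G × H) := by
  obtain ⟨U, hU, hUc, hUgen⟩ := hG
  obtain ⟨V, hV, hVc, hVgen⟩ := hH
  refine ⟨U ×ˢ V, prod_mem_nhds hU hV, hUc.prod hVc, ?_⟩
  rw [AddSubgroup.closure_prod (mem_of_mem_nhds hU) (mem_of_mem_nhds hV), hUgen, hVgen,
    AddSubgroup.top_prod_top]

lemma exists_isApproximateAddSubgroup [IsTopologicalAddGroup G]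
    (hG : IsPrecompactlyGenerated G) : ∃ (W : Set G) (K : ℝ), W ∈ 𝓝 0 ∧ IsPrecompact W ∧
      IsApproximateAddSubgroup K W ∧ AddSubgroup.closure W = ⊤ := by
  obtain ⟨U, hU, hUc, hgen⟩ := hG
  have hW0 : U ∪ -U ∈ 𝓝 (0 : G) := Filter.mem_of_superset hU Set.subset_union_left
  have hWc : IsPrecompact (U ∪ -U) := hUc.union hUc.neg
  have hWneg : -(U ∪ -U) = U ∪ -U := by rw [Set.union_neg, neg_neg, Set.union_comm]
  obtain ⟨K, hW⟩ := exists_isApproximateAddSubgroup_of_finitelyCoveredBy (mem_of_mem_nhds hW0)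
    hWneg (isPrecompact_iff.1 (hWc.add hWc) _ hW0)
  exact ⟨U ∪ -U, K, hW0, hWc, hW,
    eq_top_iff.2 (hgen ▸ AddSubgroup.closure_mono Set.subset_union_left)⟩

theorem addSubgroup [IsTopologicalAddGroup G] (hG : IsPrecompactlyGenerated G)
    (A : AddSubgroup G) : IsPrecompactlyGenerated A := by
  obtain ⟨W, K, hW0, hWc, hW, hgen⟩ := hG.exists_isApproximateAddSubgroup
  obtain ⟨T, hT, hA⟩ := exists_finitelyCoveredBy_le_closure hW hgen A
  refine ⟨A.subtype ⁻¹' (T ∪ W), continuous_subtype_val.continuousAt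
    (Filter.mem_of_superset hW0 Set.subset_union_right),
    ((hWc.of_finitelyCoveredBy hT).union hWc).preimage _ .subtypeVal, ?_⟩
  refine AddSubgroup.map_injective A.subtype_injective (le_antisymm ?_ ?_)
  · exact AddSubgroup.map_mono le_top
  · rw [← AddMonoidHom.range_eq_map, AddSubgroup.range_subtype, AddMonoidHom.map_closure,
      Set.image_preimage_eq_inter_range, ← AddMonoidHom.coe_range, AddSubgroup.range_subtype,
      Set.inter_comm]
    exact hA.trans (AddSubgroup.closure_mono
      (Set.inter_subset_inter_right _ Set.subset_union_left))

theorem of_extension {G' G'' : Type u} [AddCommGroup G'] [TopologicalSpace G'] [AddCommGroup G'']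
    [TopologicalSpace G''] (hG' : IsPrecompactlyGenerated G') (hG : IsLocallyPrecompact G)
    (hG'' : IsPrecompactlyGenerated G'') (i : G' →+ G) (hi : Continuous i) (j : G →+ G'')
    (hj : IsOpenMap j) (hjs : Function.Surjective j) (hij : Function.Exact i j) :
    IsPrecompactlyGenerated G := by
  obtain ⟨U', -, hU'c, hU'gen⟩ := hG'
  obtain ⟨U, hU, hUc⟩ := hG
  obtain ⟨U'', -, hU''c, hU''gen⟩ := hG''
  have hjU : j '' U ∈ 𝓝 0 := map_zero j ▸ hj.image_mem_nhds hU
  obtain ⟨T, ⟨F, hF, hTF⟩, hU''T⟩ := (isPrecompact_iff.1 hU''c _ hjU).exists_subset_image hjs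
  let V := i '' U' ∪ (F ∪ U)
  refine ⟨V, Filter.mem_of_superset hU fun x hx => .inr (.inr hx),
    (hU'c.image i hi).union ((IsPrecompact.of_finite hF).union hUc), ?_⟩
  have hker : j.ker ≤ AddSubgroup.closure V := by
    rw [hij.addMonoidHom_ker_eq, AddMonoidHom.range_eq_map, ← hU'gen, AddMonoidHom.map_closure]
    exact AddSubgroup.closure_mono Set.subset_union_left
  have hT : T ⊆ AddSubgroup.closure V := by
    intro x hx
    obtain ⟨f, hf, u, hu, rfl⟩ := hTF hx
    exact add_mem (AddSubgroup.subset_closure (.inr (.inl hf)))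
      (AddSubgroup.subset_closure (.inr (.inr hu)))
  have hmap : (AddSubgroup.closure V).map j = ⊤ := by
    rw [eq_top_iff, ← hU''gen, AddSubgroup.closure_le]
    exact hU''T.trans (Set.image_mono hT)
  rw [← AddSubgroup.comap_map_eq_self hker, hmap, AddSubgroup.comap_top]

end IsPrecompactlyGenerated

end Precompact

section Preadditive

variable {C : Type u} [Category.{v} C] [Preadditive C] {K K' X Y Q Q' : C}

namespace IsKernelOf

variable {i : K ⟶ X} {i' : K' ⟶ X} {f : X ⟶ Y}

lemma of_mono [Mono i] (w : i ≫ f = 0)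
    (h : ∀ {Z : C} (t : Z ⟶ X), t ≫ f = 0 → ∃ l : Z ⟶ K, l ≫ i = t) : IsKernelOf i f :=
  ⟨w, ⟨KernelFork.IsLimit.ofι' i w fun t ht => ⟨_, (h t ht).choose_spec⟩⟩⟩

lemma mono (h : IsKernelOf i f) : Mono i :=
  let ⟨_, ⟨hi⟩⟩ := h
  mono_of_isLimit_fork hi

lemma exists_lift (h : IsKernelOf i f) {Z : C} (t : Z ⟶ X) (ht : t ≫ f = 0) :
    ∃ l : Z ⟶ K, l ≫ i = t :=
  let ⟨_, ⟨hi⟩⟩ := h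
  ⟨_, (KernelFork.IsLimit.lift' hi t ht).2⟩

lemma hasKernel (h : IsKernelOf i f) : HasKernel f :=
  let ⟨_, ⟨hi⟩⟩ := h
  ⟨⟨⟨_, hi⟩⟩⟩

lemma mono_iff_isZero (h : IsKernelOf i f) : Mono f ↔ IsZero K :=
  let ⟨_, ⟨hi⟩⟩ := h
  Preadditive.mono_iff_isZero_kernel' _ hi

lemma exists_iso (h : IsKernelOf i f) (h' : IsKernelOf i' f) : ∃ e : K ≅ K', e.hom ≫ i' = i :=
  let ⟨_, ⟨hi⟩⟩ := h
  let ⟨_, ⟨hi'⟩⟩ := h'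
  ⟨hi.conePointUniqueUpToIso hi', hi.conePointUniqueUpToIso_hom_comp hi' .zero⟩

lemma iso_comp (h : IsKernelOf i f) (e : K' ≅ K) : IsKernelOf (e.hom ≫ i) f :=
  let ⟨w, ⟨hi⟩⟩ := h
  ⟨by rw [Category.assoc, w, comp_zero], ⟨IsKernel.isoKernel f _ hi e rfl⟩⟩

lemma cokernelπ [HasCokernel i] (h : IsKernelOf i f) : IsKernelOf i (cokernel.π i) := by
  have := h.mono
  refine of_mono (cokernel.condition i) fun t ht => h.exists_lift t ?_
  rw [← cokernel.π_desc i f h.choose, ← Category.assoc, ht, zero_comp]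

end IsKernelOf

namespace IsCokernelOf

variable {p : Y ⟶ Q} {p' : Y ⟶ Q'} {f : X ⟶ Y}

lemma of_epi [Epi p] (w : f ≫ p = 0)
    (h : ∀ {Z : C} (t : Y ⟶ Z), f ≫ t = 0 → ∃ l : Q ⟶ Z, p ≫ l = t) : IsCokernelOf p f :=
  ⟨w, ⟨CokernelCofork.IsColimit.ofπ' p w fun t ht => ⟨_, (h t ht).choose_spec⟩⟩⟩

lemma epi (h : IsCokernelOf p f) : Epi p :=
  let ⟨_, ⟨hp⟩⟩ := h
  epi_of_isColimit_cofork hp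

lemma exists_desc (h : IsCokernelOf p f) {Z : C} (t : Y ⟶ Z) (ht : f ≫ t = 0) :
    ∃ l : Q ⟶ Z, p ≫ l = t :=
  let ⟨_, ⟨hp⟩⟩ := h
  ⟨_, (CokernelCofork.IsColimit.desc' hp t ht).2⟩

lemma hasCokernel (h : IsCokernelOf p f) : HasCokernel f :=
  let ⟨_, ⟨hp⟩⟩ := h
  ⟨⟨⟨_, hp⟩⟩⟩

lemma epi_iff_isZero (h : IsCokernelOf p f) : Epi f ↔ IsZero Q :=
  let ⟨_, ⟨hp⟩⟩ := h
  Preadditive.epi_iff_isZero_cokernel' _ hp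

lemma exists_iso (h : IsCokernelOf p f) (h' : IsCokernelOf p' f) :
    ∃ e : Q ≅ Q', p ≫ e.hom = p' :=
  let ⟨_, ⟨hp⟩⟩ := h
  let ⟨_, ⟨hp'⟩⟩ := h'
  ⟨hp.coconePointUniqueUpToIso hp', hp.comp_coconePointUniqueUpToIso_hom hp' .one⟩

lemma comp_iso (h : IsCokernelOf p f) (e : Q ≅ Q') : IsCokernelOf (p ≫ e.hom) f :=
  let ⟨w, ⟨hp⟩⟩ := h
  ⟨by rw [← Category.assoc, w, zero_comp], ⟨IsCokernel.cokernelIso f _ hp e rfl⟩⟩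

lemma kernelι [HasKernel p] (h : IsCokernelOf p f) : IsCokernelOf p (kernel.ι p) := by
  have := h.epi
  refine of_epi (kernel.condition p) fun t ht => h.exists_desc t ?_
  rw [← kernel.lift_ι p f h.choose, Category.assoc, ht, comp_zero]

end IsCokernelOf

lemma isKernelOf_kernelι (f : X ⟶ Y) [HasKernel f] : IsKernelOf (kernel.ι f) f :=
  ⟨kernel.condition f, ⟨kernelIsKernel f⟩⟩

lemma isCokernelOf_cokernelπ (f : X ⟶ Y) [HasCokernel f] : IsCokernelOf (cokernel.π f) f :=
  ⟨cokernel.condition f, ⟨cokernelIsCokernel f⟩⟩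

section Admissible

variable [HasKernels C] [HasCokernels C] (f : X ⟶ Y)

lemma mono_and_isAdmissible_iff_isKernelOf :
    Mono f ∧ IsAdmissible f ↔ IsKernelOf f (cokernel.π f) := by
  have hfac := Abelian.coimage_image_factorisation f
  have hπ [Mono f] : IsIso (Abelian.coimage.π f) :=
    cokernel.π_of_zero (zero_of_comp_mono f (kernel.condition f))
  constructor
  · rintro ⟨hf, hadm : IsIso _⟩
    have h := (isKernelOf_kernelι (cokernel.π f)).iso_comp
      (asIso (Abelian.coimage.π f) ≪≫ asIso (Abelian.coimageImageComparison f))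
    rwa [Iso.trans_hom, asIso_hom, asIso_hom, Category.assoc, hfac] at h
  · intro h
    have := h.mono
    obtain ⟨e, he⟩ := h.exists_iso (isKernelOf_kernelι (cokernel.π f))
    have hcomp : Abelian.coimage.π f ≫ Abelian.coimageImageComparison f = e.hom := by
      rw [← cancel_mono (kernel.ι (cokernel.π f)), he, Category.assoc, hfac]
    have : IsIso (Abelian.coimage.π f ≫ Abelian.coimageImageComparison f) := hcomp ▸ inferInstance
    exact ⟨h.mono, IsIso.of_isIso_comp_left (Abelian.coimage.π f) _⟩

lemma epi_and_isAdmissible_iff_isCokernelOf :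
    Epi f ∧ IsAdmissible f ↔ IsCokernelOf f (kernel.ι f) := by
  have hfac := Abelian.coimage_image_factorisation f
  have hι [Epi f] : IsIso (Abelian.image.ι f) :=
    kernel.ι_of_zero (zero_of_epi_comp f (cokernel.condition f))
  constructor
  · rintro ⟨hf, hadm : IsIso _⟩
    have h := (isCokernelOf_cokernelπ (kernel.ι f)).comp_iso
      (asIso (Abelian.coimageImageComparison f) ≪≫ asIso (Abelian.image.ι f))
    rwa [Iso.trans_hom, asIso_hom, asIso_hom, hfac] at h
  · intro h
    have := h.epi
    obtain ⟨e, he⟩ := (isCokernelOf_cokernelπ (kernel.ι f)).exists_iso h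
    have hcomp : Abelian.coimageImageComparison f ≫ Abelian.image.ι f = e.hom := by
      rw [← cancel_epi (cokernel.π (kernel.ι f)), he, hfac]
    have : IsIso (Abelian.coimageImageComparison f ≫ Abelian.image.ι f) := hcomp ▸ inferInstance
    exact ⟨h.epi, IsIso.of_isIso_comp_right _ (Abelian.image.ι f)⟩

end Admissible

end Preadditive

section Topology

lemma isClosedEmbedding_of_pushout {A B X Q : Type*} [AddCommGroup A] [TopologicalSpace A]
    [AddCommGroup B] [TopologicalSpace B] [AddCommGroup X] [TopologicalSpace X] [ContinuousAdd X]
    [AddCommGroup Q] [TopologicalSpace Q] {f : A →+ B} {g : A →+ X} {g' : B →+ Q} {f' : X →+ Q}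
    (hf : IsClosedEmbedding f) (hg : Continuous g) (hf' : Continuous f')
    (hq : IsQuotientMap (g'.coprod f')) (hker : ∀ b x, g' b + f' x = 0 ↔ ∃ a, f a = b ∧ -g a = x) :
    IsClosedEmbedding f' := by
  refine .of_continuous_injective_isClosedMap hf' ((injective_iff_map_eq_zero f').2 fun x hx => ?_)
    fun S hS => ?_
  · obtain ⟨a, ha, rfl⟩ := (hker 0 x).1 (by rw [map_zero, zero_add, hx])
    rw [hf.injective (ha.trans (map_zero f).symm), map_zero, neg_zero]
  · have hpre : g'.coprod f' ⁻¹' (f' '' S) = Prod.map f id '' {w : A × X | w.2 + g w.1 ∈ S} := by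
      ext ⟨b, x⟩
      constructor
      · rintro ⟨y, hy, hyx⟩
        obtain ⟨a, rfl, ha⟩ := (hker b (x - y)).1 <| by
          rw [map_sub, hyx, AddMonoidHom.coprod_apply]
          abel
        refine ⟨(a, x), ?_, rfl⟩
        rwa [Set.mem_ofPred_eq, eq_add_of_sub_eq ha.symm, neg_add_cancel_comm]
      · rintro ⟨⟨a, x⟩, hx, ⟨⟩⟩
        refine ⟨_, hx, ?_⟩
        have hfg : g' (f a) = f' (g a) := by
          rw [← sub_eq_zero, sub_eq_add_neg, ← map_neg]
          exact (hker _ _).2 ⟨a, rfl, rfl⟩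
        simp only [map_add, AddMonoidHom.coprod_apply, id, hfg, add_comm]
    rw [← hq.isClosed_preimage, hpre]
    exact (hf.prodMap .id).isClosedMap _
      (hS.preimage (continuous_snd.add (hg.comp continuous_fst)))

lemma isOpenQuotientMap_of_pullback {Q A Y B : Type*} [TopologicalSpace Q] [TopologicalSpace A]
    [TopologicalSpace Y] [TopologicalSpace B] {u : Q → A} {v : Q → Y} {f : A → B} {g : Y → B}
    (hf : IsOpenQuotientMap f) (hg : Continuous g) (huv : IsInducing fun q => (u q, v q))
    (hrange : ∀ a y, f a = g y ↔ ∃ q, u q = a ∧ v q = y) : IsOpenQuotientMap v := by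
  refine ⟨fun y => ?_, continuous_snd.comp huv.continuous, isOpenMap_iff_nhds_le.2 fun q => ?_⟩
  · obtain ⟨a, ha⟩ := hf.surjective (g y)
    exact ((hrange a y).1 ha).imp fun q hq => hq.2
  · rw [huv.nhds_eq_comap, nhds_prod_eq,
      (((𝓝 _).basis_sets.prod (𝓝 _).basis_sets).comap _ |>.map v).ge_iff]
    rintro ⟨U, V⟩ ⟨hU, hV⟩
    have hfU : f '' U ∈ 𝓝 (g (v q)) := by
      rw [← (hrange _ _).2 ⟨q, rfl, rfl⟩]
      exact hf.isOpenMap.image_mem_nhds hU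
    filter_upwards [hV, hg.continuousAt hfU] with y hyV ⟨a, haU, hay⟩
    obtain ⟨q', rfl, rfl⟩ := (hrange a y).1 hay
    exact ⟨q', ⟨haU, hyV⟩, rfl⟩

end Topology

namespace HA

section

variable {X Y Z : HA.{u}}

lemma hom_ext {f g : X ⟶ Y} (h : ∀ x, f x = g x) : f = g :=
  ConcreteCategory.hom_ext _ _ h

lemma comp_eq_zero_iff {f : X ⟶ Y} {g : Y ⟶ Z} : f ≫ g = 0 ↔ ∀ x, g (f x) = 0 :=
  ⟨fun h x => congr($h x), fun h => hom_ext h⟩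

lemma continuous_hom (f : X ⟶ Y) : Continuous f := f.toContHom.continuous_toFun

lemma mem_closedRange (f : X ⟶ Y) (x : X) : f x ∈ closedRange f :=
  AddSubgroup.le_topologicalClosure _ ⟨x, rfl⟩

lemma mem_closedRange_iff {f : X ⟶ Y} (hf : IsClosed (Set.range f)) {y : Y} :
    y ∈ closedRange f ↔ ∃ x, f x = y :=
  show y ∈ closure (Set.range f) ↔ y ∈ Set.range f by rw [hf.closure_eq]

lemma closedRange_eq_top_iff (f : X ⟶ Y) : closedRange f = ⊤ ↔ DenseRange f := by
  rw [← SetLike.coe_set_eq, AddSubgroup.coe_top]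
  exact dense_iff_closure_eq.symm

/-- An isomorphism of Hausdorff abelian groups, as a homeomorphism. -/
def homeomorphOfIso (e : X ≅ Y) : X ≃ₜ Y where
  toFun := e.hom
  invFun := e.inv
  left_inv x := congr($e.hom_inv_id x)
  right_inv x := congr($e.inv_hom_id x)
  continuous_toFun := continuous_hom e.hom
  continuous_invFun := continuous_hom e.inv

lemma isKernelOf_of_isEmbedding {i : X ⟶ Y} {f : Y ⟶ Z} (hi : IsEmbedding i)
    (hex : Function.Exact i f) : IsKernelOf i f := by
  have : Mono i := ConcreteCategory.mono_of_injective i hi.injective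
  refine .of_mono (comp_eq_zero_iff.2 hex.apply_apply_eq_zero) fun t ht => ?_
  choose l hl using fun w => (hex (t w)).1 (comp_eq_zero_iff.1 ht w)
  refine ⟨⟨AddMonoidHom.mk' l fun a b => hi.injective ?_, ?_⟩, hom_ext hl⟩
  · rw [hl, map_add, map_add, hl, hl]
  · exact hi.continuous_iff.2 ((continuous_hom t).congr fun w => (hl w).symm)

lemma isCokernelOf_of_isQuotientMap {f : X ⟶ Y} {p : Y ⟶ Z} (hp : IsQuotientMap p)
    (hker : ∀ y, p y = 0 ↔ y ∈ closedRange f) : IsCokernelOf p f := by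
  have : Epi p := ConcreteCategory.epi_of_surjective p hp.surjective
  refine .of_epi (comp_eq_zero_iff.2 fun x => (hker _).2 (mem_closedRange f x)) fun {W} t ht => ?_
  have hle : closedRange f ≤ kerSubgroup t :=
    AddSubgroup.topologicalClosure_minimal _ (by rintro _ ⟨x, rfl⟩; exact comp_eq_zero_iff.1 ht x)
      (isClosed_kerSubgroup t)
  let l : Z →+ W := p.toContHom.toAddMonoidHom.liftOfSurjective hp.surjective
    ⟨t.toContHom.toAddMonoidHom, fun y hy => hle ((hker y).1 hy)⟩
  have hl : ∀ y, l (p y) = t y := AddMonoidHom.liftOfRightInverse_comp_apply _ _ _ _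
  exact ⟨⟨l, hp.continuous_iff.2 ((continuous_hom t).congr fun y => (hl y).symm)⟩, hom_ext hl⟩

lemma isClosedEmbedding_subι {A : AddSubgroup X} (hA : IsClosed (A : Set X)) :
    IsClosedEmbedding (X.subι A) := hA.isClosedEmbedding_subtypeVal

lemma isOpenQuotientMap_quotπ (A : AddSubgroup X) (hA : IsClosed (A : Set X)) :
    IsOpenQuotientMap (X.quotπ A hA) := QuotientAddGroup.isOpenQuotientMap_mk

lemma quotπ_eq_zero_iff (A : AddSubgroup X) (hA : IsClosed (A : Set X)) (x : X) :
    X.quotπ A hA x = 0 ↔ x ∈ A := QuotientAddGroup.eq_zero_iff x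

lemma exact_subι {A : AddSubgroup X} {f : X ⟶ Y} (h : ∀ x, f x = 0 ↔ x ∈ A) :
    Function.Exact (X.subι A) f :=
  fun x => (h x).trans ⟨fun hx => ⟨⟨x, hx⟩, rfl⟩, by rintro ⟨a, rfl⟩; exact a.2⟩

lemma isKernelOf_subι {A : AddSubgroup X} {f : X ⟶ Y} (h : ∀ x, f x = 0 ↔ x ∈ A) :
    IsKernelOf (X.subι A) f :=
  isKernelOf_of_isEmbedding IsEmbedding.subtypeVal (exact_subι h)

lemma isCokernelOf_quotπ {f : X ⟶ Y} {A : AddSubgroup Y} (hA : IsClosed (A : Set Y))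
    (h : closedRange f = A) : IsCokernelOf (Y.quotπ A hA) f :=
  isCokernelOf_of_isQuotientMap (isOpenQuotientMap_quotπ A hA).isQuotientMap fun y => by
    rw [quotπ_eq_zero_iff, h]

lemma closedRange_subι {A : AddSubgroup X} (hA : IsClosed (A : Set X)) :
    closedRange (X.subι A) = A := by
  ext x
  rw [mem_closedRange_iff (isClosedEmbedding_subι hA).isClosed_range]
  exact ⟨by rintro ⟨a, rfl⟩; exact a.2, fun hx => ⟨⟨x, hx⟩, rfl⟩⟩

/-- The product of two Hausdorff abelian groups. -/
def prod (X Y : HA.{u}) : HA.{u} where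
  carrier := X × Y

/-- The trivial group. -/
def trivial : HA.{u} where
  carrier := PUnit

end

section FullSubcategory

variable {P : ObjectProperty HA.{u}} {X Y Z : P.FullSubcategory}

lemma isKernelOf_of_hom {i : X ⟶ Y} {f : Y ⟶ Z} (h : IsKernelOf i.hom f.hom) :
    IsKernelOf i f := by
  have := h.mono
  have : Mono i := ⟨fun a b hab =>
    ObjectProperty.hom_ext _ ((cancel_mono i.hom).1 congr(($hab).hom))⟩
  refine .of_mono (ObjectProperty.hom_ext _ h.choose) fun t ht => ?_
  obtain ⟨l, hl⟩ := h.exists_lift t.hom congr(($ht).hom)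
  exact ⟨ObjectProperty.homMk l, ObjectProperty.hom_ext _ hl⟩

lemma isCokernelOf_of_hom {f : X ⟶ Y} {p : Y ⟶ Z} (h : IsCokernelOf p.hom f.hom) :
    IsCokernelOf p f := by
  have := h.epi
  have : Epi p := ⟨fun a b hab =>
    ObjectProperty.hom_ext _ ((cancel_epi p.hom).1 congr(($hab).hom))⟩
  refine .of_epi (ObjectProperty.hom_ext _ h.choose) fun t ht => ?_
  obtain ⟨l, hl⟩ := h.exists_desc t.hom congr(($ht).hom)
  exact ⟨ObjectProperty.homMk l, ObjectProperty.hom_ext _ hl⟩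

lemma isZero_iff_subsingleton : IsZero X ↔ Subsingleton X.obj := by
  rw [IsZero.iff_id_eq_zero]
  exact ⟨fun h => subsingleton_of_forall_eq 0 fun x => congr(($h).hom x),
    fun h => ObjectProperty.hom_ext _ (hom_ext fun x => Subsingleton.elim _ _)⟩

/-- The underlying space of a biproduct in a full subcategory is the product space: no closure
property of the subcategory is needed, because the projections and inclusions are continuous. -/
noncomputable def biprodHomeomorph (X Y : P.FullSubcategory) [HasBinaryBiproduct X Y] :
    (X ⊞ Y).obj ≃ₜ X.obj × Y.obj where
  toFun w := ((biprod.fst : X ⊞ Y ⟶ X).hom w, (biprod.snd : X ⊞ Y ⟶ Y).hom w)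
  invFun z := (biprod.inl : X ⟶ X ⊞ Y).hom z.1 + (biprod.inr : Y ⟶ X ⊞ Y).hom z.2
  left_inv w := congr(($(biprod.total (X := X) (Y := Y))).hom w)
  right_inv z := by
    have h₁ : (biprod.fst : X ⊞ Y ⟶ X).hom ((biprod.inl : X ⟶ X ⊞ Y).hom z.1) = z.1 :=
      congr(($(biprod.inl_fst (X := X) (Y := Y))).hom z.1)
    have h₂ : (biprod.fst : X ⊞ Y ⟶ X).hom ((biprod.inr : Y ⟶ X ⊞ Y).hom z.2) = 0 :=
      congr(($(biprod.inr_fst (X := X) (Y := Y))).hom z.2)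
    have h₃ : (biprod.snd : X ⊞ Y ⟶ Y).hom ((biprod.inl : X ⟶ X ⊞ Y).hom z.1) = 0 :=
      congr(($(biprod.inl_snd (X := X) (Y := Y))).hom z.1)
    have h₄ : (biprod.snd : X ⊞ Y ⟶ Y).hom ((biprod.inr : Y ⟶ X ⊞ Y).hom z.2) = z.2 :=
      congr(($(biprod.inr_snd (X := X) (Y := Y))).hom z.2)
    refine Prod.ext ?_ ?_
    · exact (map_add _ _ _).trans (by rw [h₁, h₂, add_zero])
    · exact (map_add _ _ _).trans (by rw [h₃, h₄, zero_add])
  continuous_toFun := (continuous_hom _).prodMk (continuous_hom _)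
  continuous_invFun :=
    ((continuous_hom _).comp continuous_fst).add ((continuous_hom _).comp continuous_snd)

variable [HasBinaryBiproduct X Y]

lemma biprodHomeomorph_lift (f : Z ⟶ X) (g : Z ⟶ Y) (z : Z.obj) :
    biprodHomeomorph X Y ((biprod.lift f g).hom z) = (f.hom z, g.hom z) :=
  Prod.ext congr(($(biprod.lift_fst f g)).hom z) congr(($(biprod.lift_snd f g)).hom z)

lemma desc_biprodHomeomorph_symm (f : X ⟶ Z) (g : Y ⟶ Z) (w : X.obj × Y.obj) :
    (biprod.desc f g).hom ((biprodHomeomorph X Y).symm w) = f.hom w.1 + g.hom w.2 :=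
  (map_add (biprod.desc f g).hom.toContHom _ _).trans <| congrArg₂ (· + ·)
    congr(($(biprod.inl_desc f g)).hom w.1) congr(($(biprod.inr_desc f g)).hom w.2)

end FullSubcategory

end HA

/-- A property of Hausdorff abelian groups which is inherited by closed subgroups, by quotients by
closed subgroups, by products and by some trivial group. Kernels, cokernels and biproducts in the
full subcategory it defines are then computed as in `HA`. -/
structure IsStableSubcategory (P : ObjectProperty HA.{u}) : Prop where
  sub : ∀ (X : HA.{u}) (A : AddSubgroup X), IsClosed (A : Set X) → P X → P (X.sub A)
  quot : ∀ (X : HA.{u}) (A : AddSubgroup X) (hA : IsClosed (A : Set X)), P X → P (X.quot A hA)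
  prod : ∀ X Y : HA.{u}, P X → P Y → P (X.prod Y)
  exists_subsingleton : ∃ X : HA.{u}, P X ∧ Subsingleton X

namespace IsStableSubcategory

open HA

variable {P : ObjectProperty HA.{u}} (hP : IsStableSubcategory P) {X Y Z Q : P.FullSubcategory}

include hP

lemma prop_ker (f : X ⟶ Y) : P (ker f.hom) := hP.sub _ _ (isClosed_kerSubgroup _) X.property

lemma prop_im (f : X ⟶ Y) : P (im f.hom) := hP.sub _ _ (isClosed_closedRange _) Y.property

lemma prop_coker (f : X ⟶ Y) : P (coker f.hom) := hP.quot _ _ _ Y.property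

lemma prop_coim (f : X ⟶ Y) : P (coim f.hom) := hP.quot _ _ _ X.property

lemma isKernelOf_kerι (f : X ⟶ Y) : IsKernelOf
    (ObjectProperty.homMk (kerι f.hom) : (⟨ker f.hom, hP.prop_ker f⟩ : P.FullSubcategory) ⟶ X) f :=
  isKernelOf_of_hom (isKernelOf_subι fun _ => Iff.rfl)

lemma isCokernelOf_cokerπ (f : X ⟶ Y) : IsCokernelOf
    (ObjectProperty.homMk (cokerπ f.hom) :
      Y ⟶ (⟨coker f.hom, hP.prop_coker f⟩ : P.FullSubcategory)) f :=
  isCokernelOf_of_hom (isCokernelOf_quotπ _ rfl)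

lemma mono_iff_ker_isZero (f : X ⟶ Y) :
    Mono f ↔ IsZero (⟨ker f.hom, hP.prop_ker f⟩ : P.FullSubcategory) :=
  (hP.isKernelOf_kerι f).mono_iff_isZero

lemma epi_iff_coker_isZero (f : X ⟶ Y) :
    Epi f ↔ IsZero (⟨coker f.hom, hP.prop_coker f⟩ : P.FullSubcategory) :=
  (hP.isCokernelOf_cokerπ f).epi_iff_isZero

lemma mono_iff_injective (f : X ⟶ Y) : Mono f ↔ Function.Injective f.hom := by
  rw [hP.mono_iff_ker_isZero, isZero_iff_subsingleton, ← not_nontrivial_iff_subsingleton]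
  exact (kerSubgroup f.hom).nontrivial_iff_ne_bot.not_left.trans
    (AddMonoidHom.ker_eq_bot_iff f.hom.toContHom.toAddMonoidHom)

lemma epi_iff_denseRange (f : X ⟶ Y) : Epi f ↔ DenseRange f.hom := by
  rw [hP.epi_iff_coker_isZero, isZero_iff_subsingleton, ← closedRange_eq_top_iff]
  exact QuotientAddGroup.subsingleton_iff

lemma computedAsInHA (f : X ⟶ Y) : ComputedAsInHA P f where
  ker_mem := hP.prop_ker f
  ker_isKernel := hP.isKernelOf_kerι f
  ker_isKernel_HA := isKernelOf_subι fun _ => Iff.rfl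
  kerι_injective := Subtype.val_injective
  kerι_isClosedMap := (isClosedEmbedding_subι (isClosed_kerSubgroup f.hom)).isClosedMap
  coker_mem := hP.prop_coker f
  coker_isCokernel := hP.isCokernelOf_cokerπ f
  coker_isCokernel_HA := isCokernelOf_quotπ _ rfl
  cokerπ_surjective := (isOpenQuotientMap_quotπ _ (isClosed_closedRange f.hom)).surjective
  cokerπ_isOpenMap := (isOpenQuotientMap_quotπ _ (isClosed_closedRange f.hom)).isOpenMap
  mono_iff_injective := hP.mono_iff_injective f
  mono_iff_ker_isZero := hP.mono_iff_ker_isZero f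
  im_mem := hP.prop_im f
  im_isKernel := isKernelOf_of_hom (isKernelOf_subι fun y => quotπ_eq_zero_iff _ _ y)
  epi_iff_denseRange := hP.epi_iff_denseRange f
  epi_iff_coker_isZero := hP.epi_iff_coker_isZero f
  coim_mem := hP.prop_coim f
  coim_isCokernel :=
    isCokernelOf_of_hom (isCokernelOf_quotπ _ (closedRange_subι (isClosed_kerSubgroup f.hom)))

lemma hasKernels : HasKernels P.FullSubcategory :=
  ⟨fun f => (hP.isKernelOf_kerι f).hasKernel⟩

lemma hasCokernels : HasCokernels P.FullSubcategory :=
  ⟨fun f => (hP.isCokernelOf_cokerπ f).hasCokernel⟩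

lemma hasFiniteBiproducts : HasFiniteBiproducts P.FullSubcategory := by
  have : HasZeroObject P.FullSubcategory := by
    obtain ⟨X, hX, hs⟩ := hP.exists_subsingleton
    exact ⟨⟨X, hX⟩, isZero_iff_subsingleton.2 hs⟩
  have : HasBinaryBiproducts P.FullSubcategory := ⟨fun X Y =>
    hasBinaryBiproduct_of_total
      { pt := ⟨X.obj.prod Y.obj, hP.prod _ _ X.property Y.property⟩
        fst := ObjectProperty.homMk ⟨.fst X.obj Y.obj⟩
        snd := ObjectProperty.homMk ⟨.snd X.obj Y.obj⟩
        inl := ObjectProperty.homMk ⟨.inl X.obj Y.obj⟩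
        inr := ObjectProperty.homMk ⟨.inr X.obj Y.obj⟩
        inl_fst := rfl
        inr_snd := rfl }
      (ObjectProperty.hom_ext _ (hom_ext Prod.fst_add_snd))⟩
  have := hasFiniteProducts_of_has_binary_and_terminal (C := P.FullSubcategory)
  exact HasFiniteBiproducts.of_hasFiniteProducts

lemma isKernelOf_iff {i : X ⟶ Y} {f : Y ⟶ Z} :
    IsKernelOf i f ↔ IsClosedEmbedding i.hom ∧ Function.Exact i.hom f.hom := by
  refine ⟨fun h => ?_, fun h => isKernelOf_of_hom (isKernelOf_of_isEmbedding h.1.isEmbedding h.2)⟩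
  obtain ⟨e, rfl⟩ := h.exists_iso (hP.isKernelOf_kerι f)
  let φ := homeomorphOfIso (P.ι.mapIso e)
  refine ⟨(isClosedEmbedding_subι (isClosed_kerSubgroup f.hom)).comp φ.isClosedEmbedding, ?_⟩
  have hex : Function.Exact (kerι f.hom) f.hom := exact_subι fun _ => Iff.rfl
  exact fun y => (hex y).trans (Set.ext_iff.1 (φ.surjective.range_comp (kerι f.hom)) y).symm

lemma isCokernelOf_iff {f : X ⟶ Y} {p : Y ⟶ Z} : IsCokernelOf p f ↔
    IsOpenQuotientMap p.hom ∧ ∀ y, p.hom y = 0 ↔ y ∈ closedRange f.hom := by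
  refine ⟨fun h => ?_,
    fun h => isCokernelOf_of_hom (isCokernelOf_of_isQuotientMap h.1.isQuotientMap h.2)⟩
  obtain ⟨e, rfl⟩ := (hP.isCokernelOf_cokerπ f).exists_iso h
  let φ := homeomorphOfIso (P.ι.mapIso e)
  refine ⟨φ.isOpenQuotientMap.comp (isOpenQuotientMap_quotπ _ (isClosed_closedRange f.hom)),
    fun y => ?_⟩
  rw [← quotπ_eq_zero_iff _ (isClosed_closedRange f.hom)]
  exact φ.injective.eq_iff' (b := (0 : coker f.hom)) (map_zero e.hom.hom.toContHom)

lemma mono_and_isAdmissible_iff [HasKernels P.FullSubcategory] [HasCokernels P.FullSubcategory]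
    (f : X ⟶ Y) : Mono f ∧ IsAdmissible f ↔ IsClosedEmbedding f.hom := by
  rw [mono_and_isAdmissible_iff_isKernelOf]
  refine ⟨fun h => (hP.isKernelOf_iff.1 h).1, fun hf => ?_⟩
  refine (hP.isKernelOf_iff (f := ObjectProperty.homMk (cokerπ f.hom)
    (Y := ⟨coker f.hom, hP.prop_coker f⟩)).2 ⟨hf, fun y => ?_⟩).cokernelπ
  exact (quotπ_eq_zero_iff _ _ y).trans (mem_closedRange_iff hf.isClosed_range)

lemma epi_and_isAdmissible_iff [HasKernels P.FullSubcategory] [HasCokernels P.FullSubcategory]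
    (f : X ⟶ Y) : Epi f ∧ IsAdmissible f ↔ IsOpenQuotientMap f.hom := by
  rw [epi_and_isAdmissible_iff_isCokernelOf]
  refine ⟨fun h => (hP.isCokernelOf_iff.1 h).1, fun hf => ?_⟩
  refine (hP.isCokernelOf_iff (f := ObjectProperty.homMk (kerι f.hom)
    (X := ⟨ker f.hom, hP.prop_ker f⟩)).2 ⟨hf, fun x => ?_⟩).kernelι
  exact (closedRange_subι (isClosed_kerSubgroup f.hom)).symm ▸ Iff.rfl

lemma isClosedEmbedding_of_isPushout [HasBinaryBiproducts P.FullSubcategory] {f : X ⟶ Y}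
    {g : X ⟶ Z} {g' : Y ⟶ Q} {f' : Z ⟶ Q} (h : IsPushout f g g' f')
    (hf : IsClosedEmbedding f.hom) : IsClosedEmbedding f'.hom := by
  obtain ⟨hq, hker⟩ := hP.isCokernelOf_iff.1
    (⟨_, ⟨h.isColimitCokernelCofork⟩⟩ : IsCokernelOf (biprod.desc g' f') (biprod.lift f (-g)))
  have hlift := biprodHomeomorph_lift f (-g)
  have hfst : (Prod.fst ∘ biprodHomeomorph Y Z) ∘ (biprod.lift f (-g)).hom = f.hom :=
    funext fun x => congr($(hlift x).1)
  have hclosed : IsClosed (Set.range (biprod.lift f (-g)).hom) :=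
    (isProperMap_of_comp_of_t2 (continuous_hom _)
      (continuous_fst.comp (biprodHomeomorph Y Z).continuous)
      (hfst ▸ hf.isProperMap)).isClosedMap.isClosed_range
  have hdesc := desc_biprodHomeomorph_symm g' f'
  refine isClosedEmbedding_of_pushout (f := f.hom.toContHom.toAddMonoidHom)
    (g := g.hom.toContHom.toAddMonoidHom) (g' := g'.hom.toContHom.toAddMonoidHom)
    (f' := f'.hom.toContHom.toAddMonoidHom) hf (continuous_hom g.hom) (continuous_hom f'.hom)
    ?_ fun y z => ?_
  · have hq' := hq.isQuotientMap.comp (biprodHomeomorph Y Z).symm.isQuotientMap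
    rwa [show _ ∘ (biprodHomeomorph Y Z).symm = _ from funext hdesc] at hq'
  · refine (hdesc (y, z)).symm.congr_left.trans ((hker _).trans ?_)
    rw [mem_closedRange_iff hclosed]
    refine exists_congr fun x => ?_
    rw [Homeomorph.eq_symm_apply, hlift, Prod.mk_inj]
    rfl

lemma isOpenQuotientMap_of_isPullback [HasBinaryBiproducts P.FullSubcategory] {f : X ⟶ Y}
    {g : Z ⟶ Y} {g' : Q ⟶ X} {f' : Q ⟶ Z} (h : IsPullback g' f' f g)
    (hf : IsOpenQuotientMap f.hom) : IsOpenQuotientMap f'.hom := by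
  obtain ⟨hi, hex⟩ := hP.isKernelOf_iff.1
    (⟨_, ⟨h.isLimitKernelFork⟩⟩ : IsKernelOf (biprod.lift g' f') (biprod.desc f (-g)))
  have hlift := biprodHomeomorph_lift g' f'
  refine isOpenQuotientMap_of_pullback hf (continuous_hom g.hom) (u := g'.hom) ?_ fun x z => ?_
  · exact funext hlift ▸ (biprodHomeomorph X Z).isInducing.comp hi.isInducing
  · have hdesc := desc_biprodHomeomorph_symm f (-g) (x, z)
    rw [← sub_eq_zero, sub_eq_add_neg]
    refine hdesc.symm.congr_left.trans ((hex _).trans (exists_congr fun q => ?_))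
    rw [Homeomorph.eq_symm_apply, hlift, Prod.mk_inj]

theorem isQuasiAbelian : IsQuasiAbelian P.FullSubcategory := by
  have := hP.hasFiniteBiproducts
  have := hP.hasKernels
  have := hP.hasCokernels
  have := hasBinaryBiproducts_of_finite_biproducts P.FullSubcategory
  have := Preadditive.hasEqualizers_of_hasKernels (C := P.FullSubcategory)
  have := Preadditive.hasCoequalizers_of_hasCokernels (C := P.FullSubcategory)
  have := hasPullbacks_of_hasBinaryProducts_of_hasEqualizers P.FullSubcategory
  have := hasPushouts_of_hasBinaryCoproducts_of_hasCoequalizers P.FullSubcategory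
  exact {
    hasPushout _ _ _ _ := inferInstance
    pushout_admissible_mono f g g' f' h hf hadm := (hP.mono_and_isAdmissible_iff f').2 <|
      hP.isClosedEmbedding_of_isPushout h <| (hP.mono_and_isAdmissible_iff f).1 ⟨hf, hadm⟩
    hasPullback _ _ _ _ := inferInstance
    pullback_admissible_epi f g g' f' h hf hadm := (hP.epi_and_isAdmissible_iff f').2 <|
      hP.isOpenQuotientMap_of_isPullback h <| (hP.epi_and_isAdmissible_iff f).1 ⟨hf, hadm⟩ }

end IsStableSubcategory

lemma isPrecompactlyGenerated_of_subsingleton (G : Type u) [AddCommGroup G] [TopologicalSpace G]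
    [Subsingleton G] : IsPrecompactlyGenerated G :=
  ⟨Set.univ, Filter.univ_mem, .of_finite (Set.toFinite _), AddSubgroup.closure_univ⟩

lemma PGA_iff (X : HA.{u}) : PGA X ↔ IsPrecompactlyGenerated X :=
  ⟨And.right, fun h => ⟨h.isLocallyPrecompact, h⟩⟩

lemma LPA.isStableSubcategory : IsStableSubcategory LPA.{u} where
  sub _ A _ hX := IsLocallyPrecompact.of_isInducing hX A.subtype .subtypeVal
  quot _ A _ hX := IsLocallyPrecompact.of_isOpenMap hX (QuotientAddGroup.mk' A)
    QuotientAddGroup.continuous_mk QuotientAddGroup.isOpenMap_coe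
  prod _ _ hX hY := IsLocallyPrecompact.prod hX hY
  exists_subsingleton := ⟨.trivial,
    (isPrecompactlyGenerated_of_subsingleton PUnit).isLocallyPrecompact,
    inferInstanceAs (Subsingleton PUnit)⟩

lemma PGA.isStableSubcategory : IsStableSubcategory PGA.{u} where
  sub _ A _ hX := (PGA_iff _).2 (hX.2.addSubgroup A)
  quot _ A _ hX := (PGA_iff _).2 (hX.2.of_isOpenMap (QuotientAddGroup.mk' A)
    QuotientAddGroup.continuous_mk QuotientAddGroup.isOpenMap_coe
    (QuotientAddGroup.mk'_surjective A))
  prod _ _ hX hY := (PGA_iff _).2 (hX.2.prod hY.2)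
  exists_subsingleton := ⟨.trivial, (PGA_iff _).2 (isPrecompactlyGenerated_of_subsingleton PUnit),
    inferInstanceAs (Subsingleton PUnit)⟩

theorem mainTheorem8 :
    -- closed subgroups and quotients of locally precompact groups
    (∀ (X : HA.{u}) (A : AddSubgroup X) (hA : IsClosed (A : Set X)),
      LPA X → LPA (X.sub A) ∧ LPA (X.quot A hA)) ∧
    -- closed subgroups and quotients of locally precompact, precompactly generated groups
    (∀ (X : HA.{u}) (A : AddSubgroup X) (hA : IsClosed (A : Set X)),
      PGA X → PGA (X.sub A) ∧ PGA (X.quot A hA)) ∧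
    -- extension-closedness
    (∀ (X' X X'' : LPA.{u}.FullSubcategory) (i : X' ⟶ X) (j : X ⟶ X''),
      HA.IsExactSequence i.hom j.hom → PGA X'.obj → PGA X''.obj → PGA X.obj) ∧
    -- kernels, cokernels, images, co-images, monics and epics
    (∀ (X Y : LPA.{u}.FullSubcategory) (f : X ⟶ Y), ComputedAsInHA LPA f) ∧
    (∀ (X Y : PGA.{u}.FullSubcategory) (f : X ⟶ Y), ComputedAsInHA PGA f) ∧
    IsQuasiAbelian LPA.{u}.FullSubcategory ∧
    IsQuasiAbelian PGA.{u}.FullSubcategory := by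
  have hL := LPA.isStableSubcategory.{u}
  have hP := PGA.isStableSubcategory.{u}
  refine ⟨fun X A hA hX => ⟨hL.sub X A hA hX, hL.quot X A hA hX⟩,
    fun X A hA hX => ⟨hP.sub X A hA hX, hP.quot X A hA hX⟩, fun X' X X'' i j h hX' hX'' => ?_,
    fun X Y f => hL.computedAsInHA f, fun X Y f => hP.computedAsInHA f,
    hL.isQuasiAbelian, hP.isQuasiAbelian⟩
  exact (PGA_iff _).2 <| hX'.2.of_extension X.property hX''.2 i.hom.toContHom.toAddMonoidHom
    (HA.continuous_hom i.hom) j.hom.toContHom.toAddMonoidHom h.isOpenMap h.surjective h.exact
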